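/- A topological dynamical system (tds) $(X,T)$ is a compact metric space $(X,\rho)$ with a continuous surjective map $T\colon X\to X$. We use the following properties. *Weak specification.* A specification is a sequence of $n\ge 2$ orbit segments $T^{[a_i,b_i)}(x_i)=(T^j(x_i))_{a_i\le j<b_i}$, $1\le i\le n$, with $x_i\in X$ and integers $0\le a_i<b_i$. It is $\varepsilon$-traced by $y\in X$ if $\rho(T^j(x_i),T^j(y))\le\varepsilon$ for all $1\le i\le n$ and $a_i\le j<b_i$. $(X,T)$ has the weak specification property if for every $\varepsilon>0$ there is a nondecreasing $M_\varepsilon\colon\mathbb N\to\mathbb N$ with $M_\varepsilon(n)/n\to0$ such that every specification with $a_i-b_{i-1}\ge M_\varepsilon(b_i-a_i)$ for $2\le i\le n$ is $\varepsilon$-traced by some point of $X$. *Almost specification.* $(X,T)$ has the almost specification property if there are functions $g\colon\mathbb N\times(0,\infty)\to\mathbb N$ and $k\colon(0,\infty)\to\mathbb N$ such that, for each $\varepsilon>0$, $g(n,\varepsilon)$ is nondecreasing in $n$ and $g(n,\varepsilon)/n\to0$ as $n\to\infty$, and such that for all $m\ge1$, $\varepsilon_1,\dots,\varepsilon_m>0$,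 $x_1,\dots,x_m\in X$ and $n_j\ge k(\varepsilon_j)$ there is $z\in X$ such that, for every $1\le j\le m$, with $l_j=n_1+\dots+n_{j-1}$, the inequality $\rho(T^i(x_j),T^{l_j+i}(z))<\varepsilon_j$ holds for at least $n_j-g(n_j,\varepsilon_j)$ of the indices $0\le i<n_j$. *Vague specification.* A sequence $(x_n)_{n\ge0}$ in $X$ is a vague pseudo-orbit if for every open $U\subseteq X^{\mathbb N_0}$ (product topology) containing all orbits $(T^k(y))_{k\ge0}$, $y\in X$, the set $\{n\ge 0:(x_{n+k})_{k\ge0}\in U\}$ has natural density one. $(X,T)$ has the vague specification property if for every vague pseudo-orbit $(x_n)_{n\ge0}$ there is $y\in X$ such that for every $\varepsilon>0$ the set $\{n\ge 0:\rho(T^n(y),x_n)<\varepsilon\}$ has natural density one. **Corollary.** Let $(X,T)$ be a tds with the weak specification property but not the almost specification property, and let $(Y,S)$ be a tds with the almost specification property but not the weak specification property. Then the product tds $(X\times Y,T\times S)$, with the maximum metric, has the vague specification property but neither the weak specification property nor the almost specification property. -/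

import Mathlib

open Filter Topology

namespace SpecDyn

/-! ### Weak specification -/

/-- A specification in `X`: a finite sequence of at least two orbit segments
`(T^j (pt i))`, `j ∈ [a i, b i)`, recorded by its intervals `[a i, b i)` and its points `pt i`. -/
structure Specification (X : Type*) where
  n : ℕ
  two_le : 2 ≤ n
  a : Fin n → ℕ
  b : Fin n → ℕ
  a_lt_b : ∀ i, a i < b i
  pt : Fin n → X

/-- For `M : ℕ → ℕ`, the specification is `M`-spaced if the gap in front of each segment (from the
second one on) is at least the value of `M` at the length of that segment:
`a i - b (i - 1) ≥ M (b i - a i)`. -/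
def Specification.IsSpaced {X : Type*} (ξ : Specification X) (M : ℕ → ℕ) : Prop :=
  ∀ i j : Fin ξ.n, (i : ℕ) + 1 = (j : ℕ) → ξ.b i + M (ξ.b j - ξ.a j) ≤ ξ.a j

/-- The specification is `ε`-traced by the point `y`. -/
def Specification.IsTracedBy {X : Type*} [MetricSpace X] (T : X → X) (ξ : Specification X)
    (ε : ℝ) (y : X) : Prop :=
  ∀ i : Fin ξ.n, ∀ j : ℕ, ξ.a i ≤ j → j < ξ.b i → dist (T^[j] (ξ.pt i)) (T^[j] y) ≤ ε

/-- The weak specification property: for every `ε > 0` there is a nondecreasing gap function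
`M : ℕ → ℕ` with `M n / n → 0` such that every `M`-spaced specification is `ε`-traced by a point. -/
def HasWeakSpecification {X : Type*} [MetricSpace X] (T : X → X) : Prop :=
  ∀ ε : ℝ, 0 < ε → ∃ M : ℕ → ℕ, Monotone M ∧
    Tendsto (fun n : ℕ => (M n : ℝ) / (n : ℝ)) atTop (𝓝 0) ∧
    ∀ ξ : Specification X, ξ.IsSpaced M → ∃ y : X, ξ.IsTracedBy T ε y

/-! ### Almost specification -/

/-- A mistake function: for each `ε > 0`, `g n ε` is nondecreasing in `n` and `g n ε / n → 0`. -/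
def IsMistakeFunction (g : ℕ → ℝ → ℕ) : Prop :=
  ∀ ε : ℝ, 0 < ε → Monotone (fun n : ℕ => g n ε) ∧
    Tendsto (fun n : ℕ => (g n ε : ℝ) / (n : ℝ)) atTop (𝓝 0)

/-- The Bowen ball with mistakes `B_n(g; x, ε)`: the points `y` whose orbit is `ε`-close to that of
`x` at all times in some `Λ ⊆ {0, …, n - 1}` with at least `n - g n ε` elements. -/
def mistakeBall {X : Type*} [MetricSpace X] (T : X → X) (g : ℕ → ℝ → ℕ) (n : ℕ) (x : X) (ε : ℝ) :
    Set X :=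
  {y | ∃ Λ ⊆ Finset.range n, n ≤ Λ.card + g n ε ∧ ∀ i ∈ Λ, dist (T^[i] x) (T^[i] y) < ε}

/-- The almost specification property: there are a mistake function `g` and a function
`k : (0, ∞) → ℕ` such that for all `m ≥ 1`, `ε_1, …, ε_m > 0`, points `x_1, …, x_m` and lengths
`n_j ≥ k ε_j` there is `z` with `T^{n_1 + ⋯ + n_{j-1}} z ∈ B_{n_j}(g; x_j, ε_j)` for every `j`. -/
def HasAlmostSpecification {X : Type*} [MetricSpace X] (T : X → X) : Prop :=
  ∃ g : ℕ → ℝ → ℕ, IsMistakeFunction g ∧ ∃ k : ℝ → ℕ,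
    ∀ m : ℕ, 1 ≤ m → ∀ (ε : Fin m → ℝ) (x : Fin m → X) (n : Fin m → ℕ),
      (∀ j, 0 < ε j) → (∀ j, k (ε j) ≤ n j) →
      ∃ z : X, ∀ j : Fin m,
        T^[∑ s ∈ Finset.Iio j, n s] z ∈ mistakeBall T g (n j) (x j) (ε j)

/-! ### Vague specification -/

/-- The set `A` of natural numbers has natural density one. -/
def HasDensityOne (A : Set ℕ) : Prop :=
  Tendsto (fun N : ℕ => ((A ∩ Set.Iio N).ncard : ℝ) / (N : ℝ)) atTop (𝓝 1)

/-- The set of forward orbits of `T`, as a subset of the sequence space with the product topology. -/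
def orbitSequences {X : Type*} (T : X → X) : Set (ℕ → X) :=
  Set.range fun (y : X) (k : ℕ) => T^[k] y

/-- A sequence is a vague pseudo-orbit of `T` if its shifts visit every open set containing all
orbits of `T` along a set of times of density one. -/
def IsVaguePseudoOrbit {X : Type*} [MetricSpace X] (T : X → X) (x : ℕ → X) : Prop :=
  ∀ U : Set (ℕ → X), IsOpen U → orbitSequences T ⊆ U →
    HasDensityOne {n : ℕ | (fun k : ℕ => x (n + k)) ∈ U}

/-- Kamae's vague specification property: for every vague pseudo-orbit there is a point `y` whose
orbit is, for each `ε > 0`, within `ε` of the pseudo-orbit along a set of times of density one. -/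
def HasVagueSpecification {X : Type*} [MetricSpace X] (T : X → X) : Prop :=
  ∀ x : ℕ → X, IsVaguePseudoOrbit T x →
    ∃ y : X, ∀ ε : ℝ, 0 < ε → HasDensityOne {n : ℕ | dist (T^[n] y) (x n) < ε}

end SpecDyn

/-!
Weak and almost specification pass from a product to each factor, because a specification (or a
family of orbit segments) of one factor becomes one of the product after adding any point of the
other factor. So the product has neither property.

For vague specification, coordinates of a vague pseudo-orbit of the product are vague pseudo-orbits,
and two sets of density one meet in a set of density one; hence the property passes to products
(`HasVagueSpecification.prodMap`), and it is enough that weak specification and almost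
specification each imply vague specification. Both factor through `HasGradedTracing`: consecutive
orbit blocks, whose lengths `L k` and precisions of order `2⁻ᵏ` depend on a level `k` that is
nondecreasing along the sequence, can be traced by one point, with a proportion of errors at most
`1 / (k + 1)` in a block of level `k`.

* Almost specification gives this directly, since the precision may vary from segment to segment.
* Under weak specification the precision is fixed for a whole specification, so the levels are
  treated one at a time: the point found for the levels below `k` is itself traced, up to the
  beginning of level `k`, as one long segment. The required gaps depend only on the length of the
  segment *after* the gap, so the length of this first segment costs nothing, and the errors `2⁻ᵏ`
  made on it at successive levels are summable (`HasWeakSpecification.hasGradedTracing`).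

Given graded tracing and a vague pseudo-orbit `x`, for each `k` the times from which `x` follows
some orbit up to `2⁻ᵏ` for `L k` steps have density one. Cutting time into consecutive blocks whose
level grows slowly enough (`exists_monotone_tendsto_eventually`), the blocks that start at a bad
time cover a set of density zero, and a point that traces the other blocks follows `x` along
density one (`HasGradedTracing.hasVagueSpecification`).
-/

namespace SpecDyn

/-! ### Natural density one -/

/-- Density one in terms of counting the exceptions: they are eventually at most `N / c` among the
first `N` integers, for every `c`. -/
theorem hasDensityOne_iff_count (p : ℕ → Prop) [DecidablePred p] :
    HasDensityOne {n | p n} ↔ ∀ c : ℕ, ∀ᶠ N in atTop, c * Nat.count (fun n => ¬ p n) N ≤ N := by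
  have hcard : ∀ N : ℕ, (({n | p n} ∩ Set.Iio N).ncard : ℝ) =
      N - Nat.count (fun n => ¬ p n) N := by
    intro N
    have h1 : ({n | p n} ∩ Set.Iio N) = ((Finset.range N).filter p : Finset ℕ) := by
      ext n; simp [and_comm]
    have h2 := Finset.card_filter_add_card_filter_not (s := Finset.range N) p
    rw [h1, Set.ncard_coe_finset, Nat.count_eq_card_filter_range, eq_sub_iff_add_eq]
    rw [Finset.card_range] at h2
    exact_mod_cast h2
  have hquot : ∀ᶠ N : ℕ in atTop, (({n | p n} ∩ Set.Iio N).ncard : ℝ) / N =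
      1 - (Nat.count (fun n => ¬ p n) N : ℝ) / N := by
    filter_upwards [eventually_gt_atTop 0] with N hN
    have : (N : ℝ) ≠ 0 := by positivity
    rw [hcard, sub_div, div_self this]
  unfold HasDensityOne
  rw [tendsto_congr' hquot]
  constructor
  · intro h c
    have h0 : Tendsto (fun N : ℕ => (Nat.count (fun n => ¬ p n) N : ℝ) / N) atTop (𝓝 0) := by
      simpa using h.const_sub 1
    have hc : (0 : ℝ) < 1 / (c + 1) := by positivity
    filter_upwards [h0.eventually_lt_const hc, eventually_gt_atTop 0] with N hN hN0
    have hNpos : (0 : ℝ) < N := by exact_mod_cast hN0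
    rw [div_lt_div_iff₀ hNpos (by positivity)] at hN
    have : Nat.count (fun n => ¬ p n) N * (c + 1) < 1 * N := by exact_mod_cast hN
    nlinarith
  · intro h
    suffices h0 : Tendsto (fun N : ℕ => (Nat.count (fun n => ¬ p n) N : ℝ) / N) atTop (𝓝 0) by
      simpa using h0.const_sub 1
    rw [Metric.tendsto_atTop']
    intro ε hε
    obtain ⟨c, hc⟩ := exists_nat_gt (1 / ε)
    obtain ⟨N₀, hN₀⟩ := eventually_atTop.1 (h c)
    refine ⟨N₀, fun N hN => ?_⟩
    have hNpos : (0 : ℝ) < N := by exact_mod_cast (Nat.zero_le _).trans_lt hN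
    have h1 : (c : ℝ) * Nat.count (fun n => ¬ p n) N ≤ N := by exact_mod_cast hN₀ N hN.le
    have hc0 : (0 : ℝ) < c := lt_trans (by positivity) hc
    rw [Real.dist_eq, sub_zero, abs_of_nonneg (by positivity), div_lt_iff₀ hNpos]
    rw [div_lt_iff₀ hε] at hc
    have h2 : (c : ℝ) * Nat.count (fun n => ¬ p n) N < c * (ε * N) := by nlinarith
    exact lt_of_mul_lt_mul_left h2 hc0.le

theorem HasDensityOne.mono {A B : Set ℕ} (hA : HasDensityOne A) (h : A ⊆ B) :
    HasDensityOne B := by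
  classical
  refine (hasDensityOne_iff_count (· ∈ B)).2 fun c => ?_
  filter_upwards [(hasDensityOne_iff_count (· ∈ A)).1 hA c] with N hN
  have hle : Nat.count (· ∉ B) N ≤ Nat.count (· ∉ A) N :=
    Nat.count_mono_left fun n _ hn hnA => hn (h hnA)
  exact (Nat.mul_le_mul_left c hle).trans hN

theorem HasDensityOne.inter {A B : Set ℕ} (hA : HasDensityOne A) (hB : HasDensityOne B) :
    HasDensityOne (A ∩ B) := by
  classical
  refine (hasDensityOne_iff_count (· ∈ A ∩ B)).2 fun c => ?_
  filter_upwards [(hasDensityOne_iff_count (· ∈ A)).1 hA (2 * c),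
    (hasDensityOne_iff_count (· ∈ B)).1 hB (2 * c)] with N hNA hNB
  have h : Nat.count (fun n => n ∉ A ∩ B) N ≤
      Nat.count (fun n => n ∉ A) N + Nat.count (fun n => n ∉ B) N := by
    simp only [Nat.count_eq_card_filter_range]
    refine le_trans (Finset.card_le_card fun n hn => ?_) (Finset.card_union_le _ _)
    simp only [Finset.mem_filter, Finset.mem_union, Set.mem_inter_iff] at hn ⊢
    tauto
  have h' := Nat.mul_le_mul_left c h
  linarith

/-! ### Products and factors -/

section Products

variable {X Y : Type*} [MetricSpace X] [MetricSpace Y] {T : X → X} {S : Y → Y}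

theorem IsVaguePseudoOrbit.map {Z W : Type*} [MetricSpace Z] [MetricSpace W] {R : Z → Z}
    {Q : W → W} {f : Z → W} (hf : Continuous f) (hfRQ : Function.Semiconj f R Q) {x : ℕ → Z}
    (hx : IsVaguePseudoOrbit R x) : IsVaguePseudoOrbit Q (f ∘ x) := by
  intro U hU hUQ
  refine hx ((fun w : ℕ → Z => f ∘ w) ⁻¹' U) (hU.preimage ?_) ?_
  · exact continuous_pi fun k => hf.comp (continuous_apply k)
  · rintro _ ⟨y, rfl⟩
    refine hUQ ⟨f y, ?_⟩
    ext k
    exact ((hfRQ.iterate_right k) y).symm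

theorem HasVagueSpecification.prodMap (hT : HasVagueSpecification T)
    (hS : HasVagueSpecification S) : HasVagueSpecification (Prod.map T S) := by
  intro x hx
  have hx₁ : IsVaguePseudoOrbit T (Prod.fst ∘ x) :=
    hx.map (f := Prod.fst) continuous_fst fun _ => rfl
  have hx₂ : IsVaguePseudoOrbit S (Prod.snd ∘ x) :=
    hx.map (f := Prod.snd) continuous_snd fun _ => rfl
  obtain ⟨y, hy⟩ := hT _ hx₁
  obtain ⟨z, hz⟩ := hS _ hx₂
  refine ⟨(y, z), fun ε hε => ((hy ε hε).inter (hz ε hε)).mono ?_⟩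
  rintro n ⟨h1, h2⟩
  simp only [Set.mem_ofPred_eq, Prod.map_iterate, Prod.dist_eq] at h1 h2 ⊢
  exact max_lt h1 h2

theorem HasWeakSpecification.of_prodMap_snd [Nonempty X]
    (h : HasWeakSpecification (Prod.map T S)) : HasWeakSpecification S := by
  intro ε hε
  obtain ⟨M, hM, hM0, h⟩ := h ε hε
  refine ⟨M, hM, hM0, fun ξ hξ => ?_⟩
  obtain ⟨y, hy⟩ := h ⟨ξ.n, ξ.two_le, ξ.a, ξ.b, ξ.a_lt_b,
    fun i => (Classical.arbitrary X, ξ.pt i)⟩ hξ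
  refine ⟨y.2, fun i j h1 h2 => le_trans ?_ (hy i j h1 h2)⟩
  simp only [Prod.map_iterate, Prod.dist_eq]
  exact le_max_right _ _

theorem HasAlmostSpecification.of_prodMap_fst [Nonempty Y]
    (h : HasAlmostSpecification (Prod.map T S)) : HasAlmostSpecification T := by
  obtain ⟨g, hg, k, h⟩ := h
  refine ⟨g, hg, k, fun m hm ε x n hε hn => ?_⟩
  obtain ⟨z, hz⟩ := h m hm ε (fun j => (x j, Classical.arbitrary Y)) n hε hn
  refine ⟨z.1, fun j => ?_⟩
  obtain ⟨Λ, hΛ, hcard, hd⟩ := hz j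
  refine ⟨Λ, hΛ, hcard, fun i hi => lt_of_le_of_lt ?_ (hd i hi)⟩
  simp only [Prod.map_iterate, Prod.dist_eq]
  exact le_max_left _ _

end Products

/-! ### Graded tracing -/

section Graded

variable {X : Type*} [MetricSpace X] {T : X → X}

/-- The starting time of the `j`-th of consecutive blocks starting at time `0`, the `i`-th of which
has level `lev i` and length `L (lev i)`. -/
def blockStart (L lev : ℕ → ℕ) (j : ℕ) : ℕ := ∑ i ∈ Finset.range j, L (lev i)

theorem blockStart_succ (L lev : ℕ → ℕ) (j : ℕ) :
    blockStart L lev (j + 1) = blockStart L lev j + L (lev j) :=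
  Finset.sum_range_succ _ _

/-- From time `s` on, the orbit of `z` traces the block of level `k` (of length `L k`) of the orbit of
`p`: it is within `2 * 2⁻ᵏ` of it outside a set `E` of at most `L k / (k + 1)` times. The factor `2`
leaves room for the sum `2⁻ᵏ + 2⁻⁽ᵏ⁺¹⁾ + ⋯`. -/
def TracesBlock (T : X → X) (L : ℕ → ℕ) (k s : ℕ) (p z : X) : Prop :=
  ∃ E ∈ (Finset.range (L k)).powerset, (k + 1) * E.card ≤ L k ∧
    ∀ r < L k, r ∉ E → dist (T^[r] p) (T^[r + s] z) ≤ 2 * (1 / 2 : ℝ) ^ k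

/-- Graded tracing: if the block lengths `L k` are large enough, then finitely many consecutive
blocks of nondecreasing levels are traced by a single point, each with the precision of its level. -/
def HasGradedTracing (T : X → X) : Prop :=
  ∃ L₀ : ℕ → ℕ, ∀ L : ℕ → ℕ, (∀ k, L₀ k ≤ L k) → ∀ lev : ℕ → ℕ, Monotone lev →
    ∀ p : ℕ → X, ∀ J : ℕ, ∃ z : X, ∀ j < J,
      TracesBlock T L (lev j) (blockStart L lev j) (p j) z

theorem eventually_mul_le_of_tendsto_div {M : ℕ → ℕ}
    (hM : Tendsto (fun n : ℕ => (M n : ℝ) / (n : ℝ)) atTop (𝓝 0)) (c : ℕ) :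
    ∀ᶠ n in atTop, c * M n ≤ n := by
  have hc : (0 : ℝ) < 1 / (c + 1) := by positivity
  filter_upwards [hM.eventually_lt_const hc, eventually_gt_atTop 0] with N hN hN0
  have hNpos : (0 : ℝ) < N := by exact_mod_cast hN0
  rw [div_lt_div_iff₀ hNpos (by positivity)] at hN
  have : M N * (c + 1) < 1 * N := by exact_mod_cast hN
  nlinarith

theorem HasAlmostSpecification.hasGradedTracing [Nonempty X] (h : HasAlmostSpecification T) :
    HasGradedTracing T := by
  obtain ⟨g, hg, k, h⟩ := h
  have hη : ∀ l : ℕ, (0 : ℝ) < 2 * (1 / 2 : ℝ) ^ l := fun l => by positivity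
  have hL : ∀ l : ℕ, ∃ L₀, ∀ n ≥ L₀, (l + 1) * g n (2 * (1 / 2 : ℝ) ^ l) ≤ n ∧
      k (2 * (1 / 2 : ℝ) ^ l) ≤ n := fun l =>
    eventually_atTop.1 ((eventually_mul_le_of_tendsto_div (hg _ (hη l)).2 (l + 1)).and
      (eventually_ge_atTop _))
  choose L₀ hL₀ using hL
  refine ⟨L₀, fun L hLL lev hlev p J => ?_⟩
  rcases Nat.eq_zero_or_pos J with rfl | hJ
  · exact ⟨Classical.arbitrary X, fun j hj => absurd hj (Nat.not_lt_zero j)⟩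
  obtain ⟨z, hz⟩ := h J hJ (fun j => 2 * (1 / 2 : ℝ) ^ lev j) (fun j => p j)
    (fun j => L (lev j)) (fun j => hη _) (fun j => (hL₀ _ _ (hLL _)).2)
  refine ⟨z, fun j hj => ?_⟩
  obtain ⟨Λ, hΛ, hcard, hd⟩ := hz ⟨j, hj⟩
  have hs : ∑ s ∈ Finset.Iio (⟨j, hj⟩ : Fin J), L (lev s) = blockStart L lev j := by
    rw [blockStart]
    refine Finset.sum_bij (fun s _ => (s : ℕ)) ?_ ?_ ?_ ?_
    · intro s hs; simpa [Fin.lt_def] using hs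
    · intro a _ b _ hab; exact Fin.ext hab
    · intro b hb
      have hb' := Finset.mem_range.1 hb
      exact ⟨⟨b, hb'.trans hj⟩, by simpa [Fin.lt_def] using hb', rfl⟩
    · intros; rfl
  rw [hs] at hd
  refine ⟨Finset.range (L (lev j)) \ Λ, by simp, ?_, fun r hr hrE => ?_⟩
  · refine le_trans (Nat.mul_le_mul_left _ ?_) (hL₀ (lev j) _ (hLL _)).1
    rw [Finset.card_sdiff_of_subset hΛ, Finset.card_range]
    exact Nat.sub_le_iff_le_add'.2 hcard
  · have hrΛ : r ∈ Λ := by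
      by_contra hc
      exact hrE (Finset.mem_sdiff.2 ⟨Finset.mem_range.2 hr, hc⟩)
    rw [Function.iterate_add_apply]
    exact (hd r hrΛ).le

/-- At a fixed precision, an orbit segment of arbitrary length `s` can be continued by `K` consecutive
blocks of length `L`, where only the first `G = o(L)` entries of each block are lost: `G` does not
depend on `s`, as gaps are governed by the segment that follows them. -/
theorem HasWeakSpecification.exists_extension (hTsurj : Function.Surjective T)
    (h : HasWeakSpecification T) {ε : ℝ} (hε : 0 < ε) (c : ℕ) :
    ∃ L₀ : ℕ, ∀ L ≥ L₀, ∃ G : ℕ, c * G ≤ L ∧ ∀ (s K : ℕ) (x : X) (p : ℕ → X), ∃ z : X,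
      (∀ t < s, dist (T^[t] x) (T^[t] z) ≤ ε) ∧
      ∀ i < K, ∀ r, G ≤ r → r < L → dist (T^[r] (p i)) (T^[r + (s + i * L)] z) ≤ ε := by
  obtain ⟨M, hM, hM0, h⟩ := h ε hε
  obtain ⟨L₀, hL₀⟩ := eventually_atTop.1 ((eventually_mul_le_of_tendsto_div hM0 (c + 2)).and
    (eventually_gt_atTop 0))
  refine ⟨L₀, fun L hL => ⟨M L, by nlinarith [(hL₀ L hL).1], fun s K x p => ?_⟩⟩
  obtain ⟨hML, hLpos⟩ := hL₀ L hL
  have hMlt : M L < L := by nlinarith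
  -- The pattern is placed one time unit later, so that the first segment is never empty.
  have hpre : ∀ (n : ℕ) (w : X), ∃ w', T^[n] w' = w := fun n => hTsurj.iterate n
  choose pre hpre using hpre
  let ξ : Specification X :=
    { n := K + 2
      two_le := by omega
      a := fun i => if (i : ℕ) = 0 then 0 else s + 1 + ((i : ℕ) - 1) * L + M L
      b := fun i => if (i : ℕ) = 0 then s + 1 else s + 1 + ((i : ℕ) - 1) * L + L
      a_lt_b := fun i => by split_ifs <;> omega
      pt := fun i => if (i : ℕ) = 0 then pre 1 x
        else pre (s + 1 + ((i : ℕ) - 1) * L) (p ((i : ℕ) - 1)) }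
  have hξ : ξ.IsSpaced M := by
    intro i j hij
    have hlen : M (ξ.b j - ξ.a j) ≤ M L := by
      apply hM
      have hj0 : (j : ℕ) ≠ 0 := by omega
      simp only [ξ, hj0, if_false]
      omega
    refine le_trans (Nat.add_le_add_left hlen _) ?_
    rcases Nat.eq_zero_or_pos (i : ℕ) with hi | hi
    · have hj : (j : ℕ) = 1 := by omega
      simp [ξ, hi, hj]
    · have hj0 : (j : ℕ) ≠ 0 := by omega
      have hi0 : (i : ℕ) ≠ 0 := by omega
      obtain ⟨q, hq⟩ := Nat.exists_eq_add_of_lt hi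
      have hj : (j : ℕ) = q + 2 := by omega
      have hi' : (i : ℕ) = q + 1 := by omega
      simp only [ξ, hj, hi', Nat.add_sub_cancel]
      simp only [Nat.add_eq_zero_iff, one_ne_zero, and_false, if_false, OfNat.ofNat_ne_zero,
        show q + 2 - 1 = q + 1 by omega]
      apply le_of_eq
      ring
  obtain ⟨y, hy⟩ := h ξ hξ
  refine ⟨T y, fun t ht => ?_, fun i hi r hr1 hr2 => ?_⟩
  · have := hy (⟨0, by simp⟩ : Fin (K + 2)) (t + 1) (by simp [ξ]) (by simpa [ξ] using ht)
    simp only [ξ, if_true, Function.iterate_succ_apply] at this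
    rwa [show T (pre 1 x) = x from hpre 1 x] at this
  · have := hy (⟨i + 1, by omega⟩ : Fin (K + 2)) (r + (s + 1 + i * L))
      (by simp [ξ]; omega) (by simp [ξ]; omega)
    simp only [ξ, Nat.add_sub_cancel, Nat.add_eq_zero_iff, one_ne_zero, and_false, if_false] at this
    rw [Function.iterate_add_apply T r (s + 1 + i * L) (pre _ _), hpre] at this
    rwa [← Function.iterate_succ_apply,
      show (r + (s + i * L)).succ = r + (s + 1 + i * L) by simp only [Nat.succ_eq_add_one]; ring]

theorem HasWeakSpecification.hasGradedTracing [Nonempty X] (hTsurj : Function.Surjective T)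
    (h : HasWeakSpecification T) : HasGradedTracing T := by
  have hη : ∀ l : ℕ, (0 : ℝ) < (1 / 2 : ℝ) ^ l := fun l => by positivity
  have hext := fun l : ℕ => h.exists_extension hTsurj (hη l) (l + 1)
  choose L₀ hL₀ using hext
  refine ⟨L₀, fun L hLL lev hlev p J => ?_⟩
  choose G hG hext using fun l => hL₀ l (L l) (hLL l)
  -- Induction on the level bound `n`. The error `2⁻ᵏ + ⋯ + 2⁻⁽ⁿ⁻¹⁾ = 2 * 2⁻ᵏ - 2 * 2⁻ⁿ` in a block
  -- of level `k` is a contribution `2⁻ᵏ` of its own level and one from each later level.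
  have key : ∀ n J : ℕ, (∀ j < J, lev j < n) → ∃ z : X, ∀ j < J, ∀ r, G (lev j) ≤ r →
      r < L (lev j) → dist (T^[r] (p j)) (T^[r + blockStart L lev j] z) ≤
        2 * (1 / 2 : ℝ) ^ lev j - 2 * (1 / 2 : ℝ) ^ n := by
    intro n
    induction n with
    | zero => exact fun J hJ => ⟨Classical.arbitrary X, fun j hj => absurd (hJ j hj) (by omega)⟩
    | succ n ih =>
      intro J hJ
      -- `I` is where level `n` begins.
      obtain ⟨I, hIJ, hI1, hI2⟩ : ∃ I ≤ J, (∀ j < I, lev j < n) ∧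
          ∀ j, I ≤ j → j < J → lev j = n := by
        clear ih
        induction J with
        | zero => exact ⟨0, le_rfl, by simp, by simp⟩
        | succ J ihJ =>
          rcases Nat.lt_or_ge (lev J) n with hlt | hge
          · exact ⟨J + 1, le_rfl, fun j hj => (hlev (Nat.lt_succ_iff.1 hj)).trans_lt hlt,
              fun j h1 h2 => by omega⟩
          · obtain ⟨I, h1, h2, h3⟩ := ihJ fun j hj => hJ j (by omega)
            refine ⟨I, by omega, h2, fun j hj1 hj2 => ?_⟩
            rcases Nat.lt_or_ge j J with hj | hj
            · exact h3 j hj1 hj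
            · have : j = J := by omega
              subst this
              have := hJ j (by omega)
              omega
      obtain ⟨x, hx⟩ := ih I hI1
      obtain ⟨z, hz1, hz2⟩ := hext n (blockStart L lev I) (J - I) x fun i => p (I + i)
      refine ⟨z, fun j hj r hr1 hr2 => ?_⟩
      rcases Nat.lt_or_ge j I with hjI | hjI
      · have h1 := hx j hjI r hr1 hr2
        have hlt : r + blockStart L lev j < blockStart L lev I := by
          have : blockStart L lev (j + 1) ≤ blockStart L lev I :=
            Finset.sum_le_sum_of_subset (Finset.range_mono hjI)
          rw [blockStart_succ] at this
          omega
        have h2 := hz1 _ hlt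
        have h3 := dist_triangle (T^[r] (p j)) (T^[r + blockStart L lev j] x)
          (T^[r + blockStart L lev j] z)
        rw [pow_succ]
        linarith
      · have hstart : ∀ i, I + i ≤ J →
            blockStart L lev (I + i) = blockStart L lev I + i * L n := by
          intro i
          induction i with
          | zero => simp
          | succ i ihi =>
            intro hi
            rw [← add_assoc, blockStart_succ, ihi (by omega), hI2 (I + i) (by omega) (by omega)]
            ring
        obtain ⟨i, rfl⟩ := Nat.exists_eq_add_of_le hjI
        rw [hI2 _ hjI hj] at hr1 hr2 ⊢
        rw [hstart i hj.le]
        refine (hz2 i (by omega) r hr1 hr2).trans (le_of_eq ?_)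
        rw [pow_succ]
        ring
  obtain ⟨z, hz⟩ := key (lev J + 1) J fun j hj => Nat.lt_succ_of_le (hlev hj.le)
  refine ⟨z, fun j hj => ⟨Finset.range (min (G (lev j)) (L (lev j))), ?_, ?_, fun r hr hrE => ?_⟩⟩
  · simp
  · rw [Finset.card_range]
    exact (Nat.mul_le_mul_left _ (min_le_left _ _)).trans (hG _)
  · refine (hz j hj r ?_ hr).trans (sub_le_self _ (by positivity))
    simp at hrE
    omega

/-- By compactness, graded tracing extends to infinite sequences of blocks; finiteness of the set of
possible error sets makes the tracing condition closed. -/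
theorem HasGradedTracing.exists_forall [CompactSpace X] (hT : Continuous T)
    (h : HasGradedTracing T) :
    ∃ L₀ : ℕ → ℕ, ∀ L : ℕ → ℕ, (∀ k, L₀ k ≤ L k) → ∀ lev : ℕ → ℕ, Monotone lev →
      ∀ p : ℕ → X, ∃ z : X, ∀ j, TracesBlock T L (lev j) (blockStart L lev j) (p j) z := by
  obtain ⟨L₀, h⟩ := h
  refine ⟨L₀, fun L hL lev hlev p => ?_⟩
  have hclosed : ∀ j, IsClosed {z | TracesBlock T L (lev j) (blockStart L lev j) (p j) z} := by
    intro j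
    have : {z | TracesBlock T L (lev j) (blockStart L lev j) (p j) z} =
        ⋃ E ∈ (Finset.range (L (lev j))).powerset, {z | (lev j + 1) * E.card ≤ L (lev j) ∧
          ∀ r < L (lev j), r ∉ E → dist (T^[r] (p j)) (T^[r + blockStart L lev j] z) ≤
            2 * (1 / 2 : ℝ) ^ lev j} := by
      ext z
      simp only [TracesBlock, Set.mem_ofPred_eq, Set.mem_iUnion, exists_prop]
    rw [this]
    refine isClosed_biUnion_finset fun E _ => ?_
    simp only [Set.ofPred_and, Set.ofPred_forall]
    refine isClosed_const.inter (isClosed_iInter fun r => isClosed_iInter fun _ =>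
      isClosed_iInter fun _ => isClosed_le ?_ continuous_const)
    exact continuous_const.dist (hT.iterate _)
  obtain ⟨z, hz⟩ := IsCompact.nonempty_iInter_of_sequence_nonempty_isCompact_isClosed
    (fun J => ⋂ j, ⋂ _ : j < J, {z | TracesBlock T L (lev j) (blockStart L lev j) (p j) z})
    (fun J => Set.iInter_mono fun j => Set.iInter_mono' fun hj => ⟨hj.trans J.lt_succ_self, le_rfl⟩)
    (fun J => by
      obtain ⟨z, hz⟩ := h L hL lev hlev p J
      exact ⟨z, by simpa using hz⟩)
    (isClosed_iInter fun j => isClosed_iInter fun _ => hclosed j).isCompact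
    (fun J => isClosed_iInter fun j => isClosed_iInter fun _ => hclosed j)
  simp only [Set.mem_iInter, Set.mem_ofPred_eq] at hz
  exact ⟨z, fun j => hz (j + 1) j j.lt_succ_self⟩

/-! ### From graded tracing to vague specification -/

/-- Diagonalization: properties that each hold eventually hold eventually along some slowly growing
index. -/
theorem exists_monotone_tendsto_eventually {P : ℕ → ℕ → Prop}
    (hP : ∀ k, ∀ᶠ N in atTop, P k N) :
    ∃ f : ℕ → ℕ, Monotone f ∧ Tendsto f atTop atTop ∧ ∀ᶠ N in atTop, P (f N) N := by
  classical
  choose t ht using fun k => eventually_atTop.1 (hP k)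
  refine ⟨fun N => Nat.findGreatest (fun k => t k ≤ N) N, ?_, ?_, ?_⟩
  · intro N N' hN
    exact Nat.findGreatest_mono (fun k hk => le_trans hk hN) hN
  · refine tendsto_atTop.2 fun k => ?_
    filter_upwards [eventually_ge_atTop (t k), eventually_ge_atTop k] with N h1 h2
    exact Nat.le_findGreatest h2 h1
  · filter_upwards [eventually_ge_atTop (t 0)] with N hN
    exact ht _ _ (Nat.findGreatest_spec (P := fun k => t k ≤ N) (Nat.zero_le N) hN)

/-- The times from which the sequence `x` is within `2⁻ᵏ` of some orbit of `T` for `L k` steps. -/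
def goodTimes (T : X → X) (x : ℕ → X) (L : ℕ → ℕ) (k : ℕ) : Set ℕ :=
  {n | ∃ y, ∀ r < L k, dist (T^[r] y) (x (n + r)) < (1 / 2 : ℝ) ^ k}

theorem IsVaguePseudoOrbit.hasDensityOne_goodTimes {x : ℕ → X} (hx : IsVaguePseudoOrbit T x)
    (L : ℕ → ℕ) (k : ℕ) : HasDensityOne (goodTimes T x L k) := by
  refine hx {w | ∃ y, ∀ r < L k, dist (T^[r] y) (w r) < (1 / 2 : ℝ) ^ k} ?_ ?_
  · have : {w : ℕ → X | ∃ y, ∀ r < L k, dist (T^[r] y) (w r) < (1 / 2 : ℝ) ^ k} =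
        ⋃ y, ⋂ r ∈ Finset.range (L k), {w | dist (T^[r] y) (w r) < (1 / 2 : ℝ) ^ k} := by
      ext w; simp
    rw [this]
    exact isOpen_iUnion fun y => isOpen_biInter_finset fun r _ =>
      isOpen_lt (continuous_const.dist (continuous_apply r)) continuous_const
  · rintro _ ⟨y, rfl⟩
    exact ⟨y, fun r _ => by rw [dist_self]; positivity⟩

theorem goodTimes_antitone {x : ℕ → X} {L : ℕ → ℕ} (hL : Monotone L) :
    Antitone (goodTimes T x L) := by
  rintro k l hkl n ⟨y, hy⟩
  exact ⟨y, fun r hr => (hy r (hr.trans_le (hL hkl))).trans_le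
    (pow_le_pow_of_le_one (by norm_num) (by norm_num) hkl)⟩

/-- The level of a block can be prescribed as a function `f` of its starting time. -/
theorem exists_blockStart_eq {L f : ℕ → ℕ} :
    ∃ lev : ℕ → ℕ, ∀ j, lev j = f (blockStart L lev j) := by
  let s : ℕ → ℕ := fun j => Nat.rec 0 (fun _ a => a + L (f a)) j
  refine ⟨fun j => f (s j), fun j => congrArg f ?_⟩
  induction j with
  | zero => rfl
  | succ j ih => rw [blockStart_succ, ← ih]

open Classical in
/-- In a block of level `k` that starts at a good time, a tracing point follows `x` with an error less
than `ε` except at `L k / (k + 1)` times; here `3 = 2 + 1` adds the errors of tracing `p` and of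
approximating `x` by `p`. -/
theorem count_block_le {L : ℕ → ℕ} {k s : ℕ} {x : ℕ → X} {p z : X} {ε : ℝ}
    (hε : 3 * (1 / 2 : ℝ) ^ k < ε) (hz : TracesBlock T L k s p z)
    (hp : ∀ r < L k, dist (T^[r] p) (x (s + r)) < (1 / 2 : ℝ) ^ k) :
    (k + 1) * Nat.count (fun r => ¬ dist (T^[s + r] z) (x (s + r)) < ε) (L k) ≤ L k := by
  obtain ⟨E, -, hE, hd⟩ := hz
  refine le_trans (Nat.mul_le_mul_left _ ?_) hE
  rw [Nat.count_eq_card_filter_range]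
  refine Finset.card_le_card fun r hr => ?_
  rw [Finset.mem_filter, Finset.mem_range] at hr
  by_contra hrE
  refine hr.2 ?_
  have h1 := hd r hr.1 hrE
  have h2 := hp r hr.1
  have h3 := dist_triangle_left (T^[s + r] z) (x (s + r)) (T^[r] p)
  rw [add_comm r s] at h1
  linarith

theorem HasGradedTracing.hasVagueSpecification [CompactSpace X] (hT : Continuous T)
    (h : HasGradedTracing T) : HasVagueSpecification T := by
  classical
  intro x hx
  obtain ⟨L₀, h⟩ := h.exists_forall hT
  -- Positive and nondecreasing lengths above `L₀`.
  let L : ℕ → ℕ := fun k => 1 + ∑ i ∈ Finset.range (k + 1), L₀ i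
  have hLmono : Monotone L := fun k l hkl => Nat.add_le_add_left
    (Finset.sum_le_sum_of_subset (Finset.range_mono (Nat.succ_le_succ hkl))) 1
  have hL₀ : ∀ k, L₀ k ≤ L k := fun k => le_trans
    (Finset.single_le_sum (fun _ _ => Nat.zero_le _) (Finset.self_mem_range_succ k))
    (Nat.le_add_left _ 1)
  have hLpos : ∀ k, 0 < L k := fun k => Nat.add_pos_left one_pos _
  obtain ⟨f, hfmono, hftop, hf⟩ := exists_monotone_tendsto_eventually
    (P := fun k N => (k + 1) * L k * Nat.count (· ∉ goodTimes T x L k) N ≤ N ∧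
      (k + 1) * L k ≤ N) fun k =>
    ((hasDensityOne_iff_count (· ∈ goodTimes T x L k)).1
      (hx.hasDensityOne_goodTimes L k) _).and (eventually_ge_atTop _)
  obtain ⟨lev, hlev⟩ := exists_blockStart_eq (L := L) (f := f)
  let s : ℕ → ℕ := blockStart L lev
  have hssucc : ∀ j, s (j + 1) = s j + L (lev j) := blockStart_succ L lev
  have hsmono : StrictMono s := strictMono_nat_of_lt_succ fun j => by
    rw [hssucc]; exact Nat.lt_add_of_pos_right (hLpos _)
  have hlevmono : Monotone lev := fun i j hij => by
    rw [hlev i, hlev j]; exact hfmono (hsmono.monotone hij)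
  have hlevtop : Tendsto lev atTop atTop := by
    rw [show lev = f ∘ s from funext hlev]
    exact hftop.comp hsmono.tendsto_atTop
  have hp : ∀ j, ∃ p : X, s j ∈ goodTimes T x L (lev j) →
      ∀ r < L (lev j), dist (T^[r] p) (x (s j + r)) < (1 / 2 : ℝ) ^ lev j := by
    intro j
    by_cases hj : s j ∈ goodTimes T x L (lev j)
    · exact hj.imp fun p hp _ => hp
    · exact ⟨x 0, fun h => absurd h hj⟩
  choose p hp using hp
  obtain ⟨z, hz⟩ := h L hL₀ lev hlevmono p
  refine ⟨z, fun ε hε => (hasDensityOne_iff_count _).2 fun c => ?_⟩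
  set B : ℕ → ℕ := Nat.count fun n => ¬ dist (T^[n] z) (x n) < ε with hB
  let b : ℕ → ℕ → ℕ := fun k => Nat.count (· ∉ goodTimes T x L k)
  have hεev : ∀ᶠ k in atTop, 3 * (1 / 2 : ℝ) ^ k < ε := by
    have : Tendsto (fun k : ℕ => 3 * (1 / 2 : ℝ) ^ k) atTop (𝓝 (3 * 0)) :=
      (tendsto_pow_atTop_nhds_zero_of_lt_one (by norm_num) (by norm_num)).const_mul 3
    rw [mul_zero] at this
    exact this.eventually_lt_const hε
  obtain ⟨j₀, hj₀⟩ := eventually_atTop.1 ((hlevtop.eventually hεev).and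
    ((hlevtop.eventually_ge_atTop (4 * c)).and (hsmono.tendsto_atTop.eventually hf)))
  -- Levels are at least `4 * c` from block `j₀` on, so blocks with a good start contribute at most
  -- `s j / (4 * c)` errors up to `s j`. The others start at bad times for the current level `lev j`,
  -- since `goodTimes` decreases with the level, and have length at most `L (lev j)`.
  have key : ∀ j ≥ j₀, 4 * c * B (s j) ≤
      4 * c * s j₀ + s j + 4 * c * (L (lev j) * b (lev j) (s j)) := by
    intro j hj
    induction j, hj using Nat.le_induction with
    | base =>
      have : B (s j₀) ≤ s j₀ := Nat.count_le _
      nlinarith [Nat.zero_le (4 * c * (L (lev j₀) * b (lev j₀) (s j₀)))]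
    | succ j hj ih =>
      have hcount : B (s (j + 1)) = B (s j) + Nat.count
          (fun r => ¬ dist (T^[s j + r] z) (x (s j + r)) < ε) (L (lev j)) := by
        rw [hssucc, hB, Nat.count_add]
      have hbmono : b (lev j) (s (j + 1)) ≤ b (lev (j + 1)) (s (j + 1)) :=
        Nat.count_mono_left fun n _ hn hn' =>
          hn (goodTimes_antitone hLmono (hlevmono j.le_succ) hn')
      have hLb : L (lev j) * b (lev j) (s (j + 1)) ≤
          L (lev (j + 1)) * b (lev (j + 1)) (s (j + 1)) :=
        Nat.mul_le_mul (hLmono (hlevmono j.le_succ)) hbmono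
      have h4 := Nat.mul_le_mul_left (4 * c) hLb
      by_cases hgood : s j ∈ goodTimes T x L (lev j)
      · have h1 := count_block_le (hj₀ j hj).1 (hz j) (hp j hgood)
        have h2 := Nat.mul_le_mul_right (Nat.count
          (fun r => ¬ dist (T^[s j + r] z) (x (s j + r)) < ε) (L (lev j)))
          ((hj₀ j hj).2.1.trans (lev j).le_succ)
        have h3 : 4 * c * (L (lev j) * b (lev j) (s j)) ≤
            4 * c * (L (lev j) * b (lev j) (s (j + 1))) :=
          Nat.mul_le_mul_left _ (Nat.mul_le_mul_left _
            (Nat.count_monotone _ (hsmono.monotone j.le_succ)))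
        have h5 := h2.trans h1
        rw [hcount, Nat.mul_add, hssucc]
        rw [hssucc] at h3 h4
        linarith
      · have h1 : Nat.count (fun r => ¬ dist (T^[s j + r] z) (x (s j + r)) < ε) (L (lev j)) ≤
          L (lev j) := Nat.count_le _
        have h2 : b (lev j) (s j) + 1 ≤ b (lev j) (s (j + 1)) := by
          have : b (lev j) (s j + 1) = b (lev j) (s j) + 1 := by
            simp only [b, Nat.count_succ, hgood, not_false_eq_true, if_true]
          rw [← this]
          exact Nat.count_monotone _ (hsmono j.lt_succ_self)
        have h3 : 4 * c * (L (lev j) * (b (lev j) (s j) + 1)) ≤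
            4 * c * (L (lev j) * b (lev j) (s (j + 1))) :=
          Nat.mul_le_mul_left _ (Nat.mul_le_mul_left _ h2)
        have h5 := Nat.mul_le_mul_left (4 * c) h1
        have h6 : s j ≤ s (j + 1) := hsmono.monotone j.le_succ
        rw [hcount, Nat.mul_add]
        nlinarith
  filter_upwards [eventually_ge_atTop (s j₀), eventually_ge_atTop (4 * c * s j₀)] with N hN1 hN2
  -- The last block, the one containing `N`, is counted entirely as an error: its length and the
  -- contribution of the bad starts are at most `s j / (lev j + 1)` by the choice of the level.
  obtain ⟨j, hj, hjN, hNj⟩ : ∃ j ≥ j₀, s j ≤ N ∧ N < s (j + 1) := by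
    have hex : ∃ i, N < s i := ⟨N + 1, (Nat.lt_succ_self N).trans_le (hsmono.id_le _)⟩
    have hpos : j₀ < Nat.find hex := by
      by_contra hc
      exact absurd (Nat.find_spec hex) (not_lt.2 ((hsmono.monotone (not_lt.1 hc)).trans hN1))
    obtain ⟨j, hj⟩ := Nat.exists_eq_add_of_lt hpos
    refine ⟨j₀ + j, Nat.le_add_right _ _, ?_, ?_⟩
    · exact not_lt.1 (Nat.find_min hex (by omega))
    · rw [← hj]; exact Nat.find_spec hex
  obtain ⟨-, hlev4, hf⟩ := hj₀ j hj
  change _ * _ * b (f (s j)) (s j) ≤ s j ∧ _ at hf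
  rw [← show lev j = f (s j) from hlev j] at hf
  have hBN : B N ≤ B (s j) + L (lev j) := by
    obtain ⟨d, rfl⟩ := Nat.exists_eq_add_of_le hjN
    rw [hB, Nat.count_add]
    refine Nat.add_le_add_left ((Nat.count_le _).trans ?_) _
    rw [hssucc] at hNj
    omega
  have h1 := Nat.mul_le_mul_left (4 * c) hBN
  have h2 := key j hj
  have h3 := Nat.mul_le_mul_right (L (lev j)) (hlev4.trans (lev j).le_succ)
  have h4 := Nat.mul_le_mul_right (b (lev j) (s j)) h3
  have h5 := hf.1
  have h6 := hf.2
  have h7 : 4 * c * (L (lev j) * b (lev j) (s j)) ≤ s j := by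
    rw [← mul_assoc]; exact h4.trans h5
  have h8 : 4 * c * L (lev j) ≤ s j := h3.trans h6
  rw [Nat.mul_add] at h1
  have h9 : 4 * (c * B N) ≤ 4 * N := by rw [← mul_assoc]; omega
  omega

end Graded

end SpecDyn

theorem mainTheorem8 {X Y : Type*} [MetricSpace X] [CompactSpace X]
    [MetricSpace Y] [CompactSpace Y] (T : X → X) (S : Y → Y)
    (hT : Continuous T) (hTsurj : Function.Surjective T)
    (hS : Continuous S) (hSsurj : Function.Surjective S)
    (hXweak : SpecDyn.HasWeakSpecification T)
    (hXalmost : ¬ SpecDyn.HasAlmostSpecification T)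
    (hYalmost : SpecDyn.HasAlmostSpecification S)
    (hYweak : ¬ SpecDyn.HasWeakSpecification S) :
    SpecDyn.HasVagueSpecification (Prod.map T S) ∧
      ¬ SpecDyn.HasWeakSpecification (Prod.map T S) ∧
      ¬ SpecDyn.HasAlmostSpecification (Prod.map T S) := by
  -- On an empty space both specification properties hold vacuously.
  have hX : Nonempty X := by
    by_contra hX
    rw [not_nonempty_iff] at hX
    refine hXalmost ⟨fun _ _ => 0, fun _ _ => ⟨monotone_const, by simp⟩, fun _ => 0, ?_⟩
    exact fun m hm _ x => (hX.false (x ⟨0, hm⟩)).elim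
  have hY : Nonempty Y := by
    by_contra hY
    rw [not_nonempty_iff] at hY
    refine hYweak fun ε _ => ⟨fun _ => 0, monotone_const, by simp, fun ξ _ => ?_⟩
    exact (hY.false (ξ.pt ⟨0, by have := ξ.two_le; omega⟩)).elim
  exact ⟨((hXweak.hasGradedTracing hTsurj).hasVagueSpecification hT).prodMap
      (hYalmost.hasGradedTracing.hasVagueSpecification hS),
    fun h => hYweak h.of_prodMap_snd, fun h => hXalmost h.of_prodMap_fst⟩
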